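/- A graph is a finite multigraph, possibly with loops and parallel edges. A \emph{map} is a graph that admits an orientation of its edges in which every vertex has out-degree exactly $1$ (an oriented loop contributes $1$ to the out-degree of its vertex), and a \emph{$k$-map} is a graph that is the union of $k$ pairwise edge-disjoint maps, each a spanning subgraph. Let $0\le \ell\le k$ be integers, and let $G$ be a graph with $n$ vertices and $kn-\ell$ edges. The following statements are equivalent: 1. $G$ is the union of $\ell$ spanning trees and $k-\ell$ maps, each map a spanning subgraph of $G$, all pairwise edge-disjoint. 2. Adding any $\ell$ new edges to $G$ (each with both ends in the vertex set of $G$; loops, and edges parallel to each other or to edges of $G$, are allowed) results in a $k$-map. -/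

import Mathlib

open scoped Graph

namespace Graph

/-- The multigraph obtained from `G` by adding, for each `i : ι`, one new edge whose ends are the
unordered pair `f i` of vertices of `G`. The ends may coincide (a loop), and a new edge may be
parallel to old edges or to other new edges. -/
def addEdges {α β ι : Type*} (G : Graph α β) (f : ι → Sym2 V(G)) : Graph α (β ⊕ ι) where
  vertexSet := V(G)
  IsLink e x y := Sum.elim (fun b => G.IsLink b x y)
    (fun i => (f i).map Subtype.val = s(x, y)) e
  isLink_symm := by
    rintro (b | i) -
    · exact ⟨fun x y h => IsLink.symm h⟩
    · refine ⟨fun x y h => ?_⟩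
      simp only [Sum.elim_inr] at h ⊢
      rw [h, Sym2.eq_swap]
  eq_or_eq_of_isLink_of_isLink := by
    rintro (b | i) x y v w h h'
    · exact IsLink.left_eq_or_eq h h'
    · simp only [Sum.elim_inr] at h h'
      rw [h, Sym2.eq_iff] at h'
      tauto
  left_mem_of_isLink := by
    rintro (b | i) x y h
    · exact IsLink.left_mem h
    · simp only [Sum.elim_inr] at h
      have hx : x ∈ (f i).map Subtype.val := by rw [h]; exact Sym2.mem_mk_left x y
      obtain ⟨a, -, rfl⟩ := Sym2.mem_map.1 hx
      exact a.2

/-- An orientation of a multigraph: each edge gets one of its ends as tail and the other as head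
(for a loop, tail and head are both the vertex of the loop). -/
structure Orientation {α β : Type*} (G : Graph α β) where
  /-- The vertex that the edge leaves. -/
  tail : E(G) → α
  /-- The vertex that the edge enters. -/
  head : E(G) → α
  isLink : ∀ e : E(G), G.IsLink e (tail e) (head e)

/-- The number of edges that leave `v`. -/
noncomputable def Orientation.outDegree {α β : Type*} {G : Graph α β} (o : G.Orientation)
    (v : α) : ℕ∞ :=
  {e : E(G) | o.tail e = v}.encard

/-- A map: a multigraph with an orientation in which every vertex has out-degree exactly one. -/
def IsMap {α β : Type*} (G : Graph α β) : Prop :=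
  ∃ o : G.Orientation, ∀ v ∈ V(G), o.outDegree v = 1

/-- A tree: no loops, no parallel edges, and connected and acyclic as a simple graph
(in particular, it has at least one vertex). -/
def IsTree {α β : Type*} (G : Graph α β) : Prop :=
  G.Simple ∧ G.toSimpleGraph.IsTree

/-- `G` is the union of the pairwise edge-disjoint spanning subgraphs `H i`: each `H i` is a
subgraph with the same vertex set as `G`, and every edge of `G` lies in exactly one `H i`. -/
structure IsEdgeDisjointUnion {α β ι : Type*} (G : Graph α β) (H : ι → Graph α β) : Prop where
  isSpanningSubgraph : ∀ i, H i ≤s G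
  disjoint : ∀ i j, i ≠ j → Disjoint E(H i) E(H j)
  iUnion_edgeSet : ⋃ i, E(H i) = E(G)

/-- A `k`-map: a multigraph that is the union of `k` edge-disjoint (spanning) maps. -/
def IsKMap {α β : Type*} (G : Graph α β) (k : ℕ) : Prop :=
  ∃ M : Fin k → Graph α β, G.IsEdgeDisjointUnion M ∧ ∀ i, (M i).IsMap

/-- `G` is the union of `a` spanning trees and `b` (spanning) maps, all pairwise edge-disjoint. -/
def IsUnionOfTreesAndMaps {α β : Type*} (G : Graph α β) (a b : ℕ) : Prop :=
  ∃ (T : Fin a → Graph α β) (M : Fin b → Graph α β),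
    G.IsEdgeDisjointUnion (Sum.elim T M) ∧ (∀ i, (T i).IsTree) ∧ ∀ j, (M j).IsMap

end Graph

/-!
A graph is a map precisely when its edges can be assigned bijectively to vertices, each edge to one
of its ends (`Graph.isMap_iff`); a `k`-map is one in which every vertex owns `k` edges.

*From trees and maps to `k`-maps.* A spanning tree directed towards a root `r` gives one edge to
every vertex other than `r`. If `r` is an end of an added edge, then `r` can own that edge, so the
tree together with the added edge is a map (`Graph.IsUnionOfTreesAndMaps.isKMap_addEdges`).

*From `k`-maps to trees and maps.* Adding `ℓ` loops at a vertex `x` forces all of them to leave `x`.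
For `x = r` this orients `G` with out-degree `k - ℓ` at `r` and `k` elsewhere. For `x ∈ X` it shows
that at most `k * #X - ℓ` edges of `G` lie inside `X`. So in the orientation for `r`, at least `ℓ`
edges leave every nonempty `X` that avoids `r`. By Edmonds' theorem on disjoint arborescences
(`exists_disjoint_inArborescence`, with Lovász's proof by uncrossing), there are `ℓ` disjoint spanning
trees directed towards `r`. They use `ℓ` out-edges at every vertex except `r` and none at `r`, so
every vertex keeps out-degree `k - ℓ`, and the remaining edges split into `k - ℓ` maps.
-/

/-! ### Packing spanning in-arborescences -/

/-- `InArborescence t h r A T`: in the digraph whose edge `e` goes from `t e` to `h e`, the edge set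
`T` is a tree on the vertex set `A` with all edges directed towards the root `r`. Such a tree is
built from the root by adding leaves one at a time. -/
inductive InArborescence {V E : Type*} [DecidableEq V] [DecidableEq E] (t h : E → V) (r : V) :
    Finset V → Finset E → Prop
  | root : InArborescence t h r {r} ∅
  | leaf {A : Finset V} {T : Finset E} {e : E} (hAT : InArborescence t h r A T)
      (ht : t e ∉ A) (hh : h e ∈ A) : InArborescence t h r (insert (t e) A) (insert e T)

namespace InArborescence

variable {V E : Type*} [DecidableEq V] [DecidableEq E] {t h : E → V} {r : V} {A : Finset V}
  {T : Finset E}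

lemma root_mem (H : InArborescence t h r A T) : r ∈ A := by
  induction H with
  | root => simp
  | leaf _ _ _ ih => exact Finset.mem_insert_of_mem ih

lemma tail_mem (H : InArborescence t h r A T) : ∀ e ∈ T, t e ∈ A := by
  induction H with
  | root => simp
  | leaf _ _ _ ih => grind

lemma head_mem (H : InArborescence t h r A T) : ∀ e ∈ T, h e ∈ A := by
  induction H with
  | root => simp
  | leaf _ _ _ ih => grind

lemma tail_ne_head (H : InArborescence t h r A T) : ∀ e ∈ T, t e ≠ h e := by
  induction H with
  | root => simp
  | leaf _ _ _ ih => grind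

lemma card_filter_tail (H : InArborescence t h r A T) :
    ∀ v ∈ A, (T.filter (t · = v)).card = if v = r then 0 else 1 := by
  induction H with
  | root => simp
  | @leaf A T e hAT ht hh ih =>
    intro v hv
    rw [Finset.filter_insert]
    have hr := hAT.root_mem
    have htm := hAT.tail_mem
    split_ifs with h1 h2 h2
    · grind
    · have : T.filter (t · = v) = ∅ := by
        rw [Finset.filter_eq_empty_iff]; grind
      simp [this]
    · have := ih v (by grind); simpa [h2] using this
    · have := ih v (by grind); simpa [h2] using this

lemma card_add_one (H : InArborescence t h r A T) : T.card + 1 = A.card := by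
  induction H with
  | root => simp
  | @leaf A T e hAT ht hh ih =>
    have : e ∉ T := fun he => ht (hAT.tail_mem e he)
    rw [Finset.card_insert_of_notMem this, Finset.card_insert_of_notMem ht, ih]

/-- There are no parallel edges, in either direction: of two edges, the one added later has a tail
that the other does not meet. -/
lemma eq_of_ends_eq (H : InArborescence t h r A T) :
    ∀ e ∈ T, ∀ f ∈ T, s(t e, h e) = s(t f, h f) → e = f := by
  induction H with
  | root => simp
  | @leaf A T e hAT ht hh ih =>
    have htm := hAT.tail_mem
    have hhm := hAT.head_mem
    intro a ha b hb hab
    rw [Sym2.eq_iff] at hab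
    rcases Finset.mem_insert.1 ha with rfl | ha' <;> rcases Finset.mem_insert.1 hb with rfl | hb'
    · rfl
    · grind
    · grind
    · exact ih a ha' b hb' (Sym2.eq_iff.2 hab)

lemma reachable (H : InArborescence t h r A T) {S : SimpleGraph V}
    (hS : ∀ e ∈ T, S.Adj (t e) (h e)) : ∀ v ∈ A, S.Reachable v r := by
  induction H with
  | root => simp
  | @leaf A T e hAT ht hh ih =>
    intro v hv
    have ih' := ih fun f hf => hS f (Finset.mem_insert_of_mem hf)
    rcases Finset.mem_insert.1 hv with rfl | hv
    · exact (hS e (Finset.mem_insert_self _ _)).reachable.trans (ih' _ hh)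
    · exact ih' v hv

end InArborescence

section Packing

variable {V E : Type*} [DecidableEq V]

/-- The number of edges of `R` that leave the vertex set `X`. -/
def cutDegree (t h : E → V) (R : Finset E) (X : Finset V) : ℕ :=
  (R.filter fun e => t e ∈ X ∧ h e ∉ X).card

lemma cutDegree_inter_add_union_le (t h : E → V) (R : Finset E) (X Y : Finset V) :
    cutDegree t h R (X ∩ Y) + cutDegree t h R (X ∪ Y) ≤ cutDegree t h R X + cutDegree t h R Y := by
  simp only [cutDegree, Finset.card_filter, ← Finset.sum_add_distrib]
  refine Finset.sum_le_sum fun e _ => ?_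
  by_cases h1 : t e ∈ X <;> by_cases h2 : t e ∈ Y <;> by_cases h3 : h e ∈ X <;>
    by_cases h4 : h e ∈ Y <;> simp [h1, h2, h3, h4]

/-- A partial arborescence that can be removed while leaving `m` edges out of every nonempty vertex
set that avoids the root can be enlarged by a leaf with the same property. -/
lemma InArborescence.exists_leaf [DecidableEq E] [Fintype V] {t h : E → V} {r : V} {m : ℕ}
    {R T : Finset E} {A : Finset V}
    (hR : ∀ X : Finset V, X.Nonempty → r ∉ X → m + 1 ≤ cutDegree t h R X)
    (hT : InArborescence t h r A T)
    (hm : ∀ X : Finset V, X.Nonempty → r ∉ X → m ≤ cutDegree t h (R \ T) X)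
    (hA : A ≠ Finset.univ) :
    ∃ e ∈ R, t e ∉ A ∧ h e ∈ A ∧
      ∀ X : Finset V, X.Nonempty → r ∉ X → m ≤ cutDegree t h (R \ insert e T) X := by
  classical
  -- Sets that meet the complement of `A` and are tight for `m`. The whole vertex set is allowed too,
  -- so that there is a minimal one even when no set is tight.
  let P : Finset V → Prop := fun X =>
    ¬ X ⊆ A ∧ (X = Finset.univ ∨ (r ∉ X ∧ cutDegree t h (R \ T) X = m))
  have hPuniv : P Finset.univ := ⟨fun hs => hA (Finset.univ_subset_iff.1 hs), Or.inl rfl⟩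
  obtain ⟨X, hPX, hXmin⟩ : ∃ X, P X ∧ ∀ Y, P Y → ¬ Y ⊂ X := by
    obtain ⟨X, hX⟩ := (Set.toFinite {X | P X}).exists_minimal ⟨_, hPuniv⟩
    exact ⟨X, hX.prop, fun Y hY hlt => hX.not_lt hY hlt⟩
  have hX1 : cutDegree t h (R \ T) X ≤ m := by
    rcases hPX.2 with rfl | ⟨-, hX⟩
    · simp [cutDegree]
    · exact hX.le
  have hXA : m + 1 ≤ cutDegree t h (R \ T) (X \ A) := by
    refine (hR (X \ A) (Finset.sdiff_nonempty.2 hPX.1) ?_).trans (Finset.card_le_card ?_)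
    · simp [hT.root_mem]
    · have := hT.tail_mem
      intro e
      simp only [Finset.mem_filter, Finset.mem_sdiff]
      grind
  -- More edges leave `X \ A` than leave `X`, so some edge goes from `X \ A` to `X ∩ A`.
  obtain ⟨e, heR, heX, heA, hhX, hhA⟩ :
      ∃ e ∈ R, t e ∈ X ∧ t e ∉ A ∧ h e ∈ X ∧ h e ∈ A := by
    by_contra! hcon
    refine absurd (hXA.trans (Finset.card_le_card (t := (R \ T).filter
      fun e => t e ∈ X ∧ h e ∉ X) ?_)) (by have : _ ≤ m := hX1; unfold cutDegree at this; omega)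
    intro e
    simp only [Finset.mem_filter, Finset.mem_sdiff]
    grind
  refine ⟨e, heR, heA, hhA, fun Y hY hrY => ?_⟩
  have hins : R \ insert e T = (R \ T).erase e := by grind
  by_cases hcut : t e ∈ Y ∧ h e ∉ Y
  · by_contra! hlt
    have hYm : cutDegree t h (R \ T) Y = m := by
      have h1 := hm Y hY hrY
      have h2 : cutDegree t h (R \ T) Y ≤ cutDegree t h (R \ insert e T) Y + 1 := by
        rw [hins, cutDegree, cutDegree, Finset.filter_erase]
        have := Finset.pred_card_le_card_erase (a := e)
          (s := (R \ T).filter fun e => t e ∈ Y ∧ h e ∉ Y)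
        omega
      omega
    -- Uncrossing: `X ∩ Y` is tight, contains `t e ∉ A`, and misses `h e ∈ X`.
    refine hXmin (X ∩ Y) ⟨fun hs => heA (hs (by simp [heX, hcut.1])), Or.inr ⟨by simp [hrY], ?_⟩⟩
      ⟨Finset.inter_subset_left, fun hs => hcut.2 (Finset.mem_inter.1 (hs hhX)).2⟩
    rcases hPX.2 with rfl | ⟨hrX, hX⟩
    · simpa using hYm
    · have h1 := cutDegree_inter_add_union_le t h (R \ T) X Y
      have h2 := hm (X ∩ Y) ⟨t e, by simp [heX, hcut.1]⟩ (by simp [hrY])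
      have h3 := hm (X ∪ Y) ⟨t e, by simp [heX]⟩ (by simp [hrX, hrY])
      omega
  · refine (hm Y hY hrY).trans_eq ?_
    rw [hins, cutDegree, cutDegree, Finset.filter_erase, Finset.erase_eq_of_notMem]
    simp [hcut]

/-- One step of Edmonds' theorem: if at least `m + 1` edges leave every nonempty vertex set that
avoids the root, then some spanning arborescence can be removed so that at least `m` remain. -/
lemma exists_inArborescence_cutDegree_sdiff [DecidableEq E] [Fintype V] {t h : E → V} {r : V}
    {m : ℕ} {R : Finset E} (hR : ∀ X : Finset V, X.Nonempty → r ∉ X → m + 1 ≤ cutDegree t h R X) :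
    ∃ T ⊆ R, InArborescence t h r Finset.univ T ∧
      ∀ X : Finset V, X.Nonempty → r ∉ X → m ≤ cutDegree t h (R \ T) X := by
  suffices ∀ n < Fintype.card V, ∃ A : Finset V, A.card = n + 1 ∧ ∃ T ⊆ R,
      InArborescence t h r A T ∧
      ∀ X : Finset V, X.Nonempty → r ∉ X → m ≤ cutDegree t h (R \ T) X by
    have hpos : 0 < Fintype.card V := Fintype.card_pos_iff.2 ⟨r⟩
    obtain ⟨A, hA, h⟩ := this (Fintype.card V - 1) (by omega)
    rwa [A.card_eq_iff_eq_univ.1 (by omega)] at h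
  intro n
  induction n with
  | zero =>
    exact fun _ => ⟨{r}, by simp, ∅, by simp, .root, fun X hX hr => by
      simpa using (Nat.le_succ m).trans (hR X hX hr)⟩
  | succ n ih =>
    intro hn
    obtain ⟨A, hA, T, hTR, hT, hm⟩ := ih (by omega)
    have hAu : A ≠ Finset.univ := by
      rintro rfl
      rw [Finset.card_univ] at hA
      omega
    obtain ⟨e, heR, ht, hh, he⟩ := hT.exists_leaf hR hm hAu
    exact ⟨insert (t e) A, by rw [Finset.card_insert_of_notMem ht, hA], insert e T,
      Finset.insert_subset heR hTR, hT.leaf ht hh, he⟩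

/-- **Edmonds' theorem** on disjoint arborescences: if at least `m` edges leave every nonempty
vertex set that avoids the root, then there are `m` pairwise disjoint spanning arborescences
directed towards the root. -/
theorem exists_disjoint_inArborescence [DecidableEq E] [Fintype V] {t h : E → V} {r : V} {m : ℕ}
    {R : Finset E} (hR : ∀ X : Finset V, X.Nonempty → r ∉ X → m ≤ cutDegree t h R X) :
    ∃ T : Fin m → Finset E, (∀ i, T i ⊆ R) ∧ (∀ i j, i ≠ j → Disjoint (T i) (T j)) ∧
      ∀ i, InArborescence t h r Finset.univ (T i) := by
  induction m generalizing R with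
  | zero => exact ⟨fun _ => ∅, by simp, by simp, fun i => i.elim0⟩
  | succ m ih =>
    obtain ⟨T₀, hT₀R, hT₀, hm⟩ := exists_inArborescence_cutDegree_sdiff hR
    obtain ⟨T, hTR, hdisj, hT⟩ := ih hm
    refine ⟨Fin.cons T₀ T, fun i => ?_, fun i j hij => ?_, fun i => ?_⟩
    · cases i using Fin.cases with
      | zero => simpa using hT₀R
      | succ i => simpa using (hTR i).trans Finset.sdiff_subset
    · have hd : ∀ i, Disjoint T₀ (T i) := fun i =>
        Finset.disjoint_sdiff.mono_right (hTR i)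
      cases i using Fin.cases with
      | zero =>
        cases j using Fin.cases with
        | zero => exact absurd rfl hij
        | succ j => simpa using hd j
      | succ i =>
        cases j using Fin.cases with
        | zero => simpa using (hd i).symm
        | succ j => simpa using hdisj i j (by simpa using hij)
    · cases i using Fin.cases with
      | zero => simpa using hT₀
      | succ i => simpa using hT i

end Packing

namespace Graph

/-! ### Maps as systems of owned edges -/

/-- A map amounts to a bijection from the vertices to the edges that sends each vertex to an edge at
that vertex, namely the edge that leaves it. The vertex set is named `W` so that spanning subgraphs
of one graph can share the domain of these bijections. -/
lemma isMap_iff {α β : Type*} {H : Graph α β} {W : Set α} (hW : V(H) = W) :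
    H.IsMap ↔ ∃ m : W → β, m.Injective ∧ Set.range m = E(H) ∧ ∀ v : W, H.Inc (m v) v := by
  subst hW
  constructor
  · rintro ⟨o, ho⟩
    have h1 : ∀ v : V(H), ∃ e : E(H), {e : E(H) | o.tail e = v} = {e} := fun v =>
      Set.encard_eq_one.1 (ho v v.2)
    choose m hm using h1
    have htail : ∀ v, o.tail (m v) = v := fun v => by
      have : m v ∈ {e : E(H) | o.tail e = v} := by rw [hm v]; rfl
      exact this
    refine ⟨fun v => m v, fun v w hvw => ?_, ?_, fun v => ?_⟩
    · rw [Subtype.ext_iff, ← htail v, ← htail w, Subtype.ext hvw]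
    · ext e
      refine ⟨?_, fun he => ?_⟩
      · rintro ⟨v, rfl⟩
        exact (m v).2
      · refine ⟨⟨o.tail ⟨e, he⟩, (o.isLink _).left_mem⟩, ?_⟩
        have h2 : (⟨e, he⟩ : E(H)) ∈ {e' : E(H) | o.tail e' = o.tail ⟨e, he⟩} := rfl
        have h3 := hm ⟨o.tail ⟨e, he⟩, (o.isLink _).left_mem⟩
        simp only at h3
        rw [h3] at h2
        exact (congrArg Subtype.val h2).symm
    · have := o.isLink (m v)
      rw [htail] at this
      exact this.inc_left
  · rintro ⟨m, hinj, hrange, hinc⟩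
    have h1 : ∀ e : E(H), ∃ v : V(H), m v = e := fun e => hrange.ge e.2
    choose t ht using h1
    have h2 : ∀ e : E(H), ∃ y, H.IsLink e (t e) y := fun e => by
      have := hinc (t e)
      rwa [ht] at this
    choose h hh using h2
    refine ⟨⟨fun e => t e, h, hh⟩, fun v hv => Set.encard_eq_one.2
      ⟨⟨m ⟨v, hv⟩, (hinc _).edge_mem⟩, ?_⟩⟩
    ext e
    simp only [Set.mem_ofPred_eq, Set.mem_singleton_iff]
    constructor
    · rintro rfl
      exact Subtype.ext (ht e).symm
    · rintro rfl
      exact congrArg Subtype.val (hinj (ht ⟨m ⟨v, hv⟩, (hinc _).edge_mem⟩))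

lemma isMap_restrict_range {α β : Type*} {G : Graph α β} {m : V(G) → β} (hm : m.Injective)
    (hinc : ∀ v, G.Inc (m v) v) : (G.restrict (Set.range m)).IsMap := by
  refine (isMap_iff rfl).2 ⟨m, hm, ?_, fun v => restrict_inc.2 ⟨hinc v, v, rfl⟩⟩
  refine (Set.inter_eq_right.2 ?_).symm
  rintro _ ⟨v, rfl⟩
  exact (hinc v).edge_mem

lemma isEdgeDisjointUnion_restrict {α β ι : Type*} {G : Graph α β} {S : ι → Set β}
    (hdisj : ∀ i j, i ≠ j → Disjoint (S i) (S j)) (hS : ⋃ i, S i = E(G)) :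
    G.IsEdgeDisjointUnion fun i => G.restrict (S i) where
  isSpanningSubgraph _ := ⟨restrict_le, rfl⟩
  disjoint i j hij := (hdisj i j hij).mono Set.inter_subset_right Set.inter_subset_right
  iUnion_edgeSet := by
    change ⋃ i, E(G) ∩ S i = E(G)
    rw [← Set.inter_iUnion, hS, Set.inter_self]

/-- In a `k`-map, the edges can be assigned to their ends so that every vertex owns exactly one edge
of each of the `k` colours. -/
lemma IsKMap.exists_injective {α β : Type*} {H : Graph α β} {k : ℕ} (hH : H.IsKMap k) :
    ∃ m : V(H) × Fin k → β, m.Injective ∧ Set.range m = E(H) ∧ ∀ p, H.Inc (m p) p.1 := by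
  obtain ⟨M, hM, hmap⟩ := hH
  have h1 := fun i => (isMap_iff (hM.isSpanningSubgraph i).vertexSet_eq).1 (hmap i)
  choose m hinj hrange hinc using h1
  refine ⟨fun p => m p.2 p.1, ?_, ?_, fun p => (hinc p.2 p.1).mono (hM.isSpanningSubgraph p.2).le⟩
  · rintro ⟨v, i⟩ ⟨w, j⟩ h
    obtain rfl | hij := eq_or_ne i j
    · exact Prod.ext (hinj i h) rfl
    · have h2 : m j w ∈ E(M i) := by
        have h3 : m i v = m j w := h
        exact h3 ▸ (hinc i v).edge_mem
      exact absurd (hinc j w).edge_mem (Set.disjoint_left.1 (hM.disjoint i j hij) h2)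
  · rw [← hM.iUnion_edgeSet]
    ext e
    simp only [← hrange, Set.mem_range, Prod.exists, Set.mem_iUnion]
    exact exists_comm

lemma isKMap_of_injective {α β ι : Type*} [Fintype ι] {H : Graph α β} {k : ℕ}
    (hι : Fintype.card ι = k) {m : V(H) × ι → β} (hinj : m.Injective) (hrange : Set.range m = E(H))
    (hinc : ∀ p, H.Inc (m p) p.1) : H.IsKMap k := by
  let c : Fin k ≃ ι := (Fintype.equivFinOfCardEq hι).symm
  refine ⟨fun i => H.restrict (Set.range fun v => m (v, c i)),
    isEdgeDisjointUnion_restrict ?_ ?_, fun i => isMap_restrict_range ?_ fun v => hinc (v, c i)⟩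
  · intro i j hij
    refine Set.disjoint_left.2 ?_
    rintro _ ⟨v, rfl⟩ ⟨w, hw⟩
    exact hij (c.injective (congrArg Prod.snd (hinj hw))).symm
  · rw [← hrange]
    ext e
    simp only [Set.mem_iUnion, Set.mem_range, Prod.exists]
    rw [exists_comm]
    exact exists_congr fun v => c.exists_congr_left.trans (by simp)
  · intro v w hvw
    exact congrArg Prod.fst (hinj hvw)

/-! ### Adding edges to trees -/

@[simp]
lemma inl_mem_edgeSet_addEdges {α β ι : Type*} {G : Graph α β} {f : ι → Sym2 V(G)} {e : β} :
    Sum.inl e ∈ E(G.addEdges f) ↔ e ∈ E(G) :=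
  (G.edge_mem_iff_exists_isLink e).symm

@[simp]
lemma inr_mem_edgeSet_addEdges {α β ι : Type*} {G : Graph α β} {f : ι → Sym2 V(G)} (i : ι) :
    Sum.inr i ∈ E(G.addEdges f) := by
  obtain ⟨⟨x, y⟩, h⟩ := (f i).exists_rep
  exact ⟨x, y, (congrArg (Sym2.map Subtype.val) h).symm⟩

@[simp]
lemma addEdges_inc_inl {α β ι : Type*} {G : Graph α β} {f : ι → Sym2 V(G)} {e : β} {v : α} :
    (G.addEdges f).Inc (Sum.inl e) v ↔ G.Inc e v :=
  Iff.rfl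

@[simp]
lemma addEdges_inc_inr {α β ι : Type*} {G : Graph α β} {f : ι → Sym2 V(G)} {i : ι} {v : V(G)} :
    (G.addEdges f).Inc (Sum.inr i) v ↔ v ∈ f i := by
  constructor
  · rintro ⟨y, hy : (f i).map Subtype.val = s((v : α), y)⟩
    have : (v : α) ∈ (f i).map Subtype.val := hy ▸ Sym2.mem_mk_left _ _
    obtain ⟨w, hw, hwv⟩ := Sym2.mem_map.1 this
    rwa [← Subtype.ext hwv]
  · intro hv
    obtain ⟨y, hy⟩ := hv
    exact ⟨y, by change (f i).map Subtype.val = _; rw [hy]; rfl⟩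

/-- Only the inequality is needed, so the proof uses no bijection between the edges of `T` and those
of `T.toSimpleGraph`. -/
lemma ncard_edgeSet_le_of_isTree {α β : Type*} {T : Graph α β} (hfin : V(T).Finite)
    (hT : T.IsTree) : E(T).Finite ∧ E(T).ncard + 1 ≤ V(T).ncard := by
  obtain ⟨hs, htree⟩ := hT
  have := hfin.to_subtype
  have hcard := (SimpleGraph.isTree_iff_connected_and_card.1 htree).2
  have h1 : ∀ e : E(T), ∃ x y : V(T), T.IsLink e x y := fun e => by
    obtain ⟨x, y, h⟩ := exists_isLink_of_mem_edgeSet e.2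
    exact ⟨⟨x, h.left_mem⟩, ⟨y, h.right_mem⟩, h⟩
  choose x y hxy using h1
  let F : E(T) → T.toSimpleGraph.edgeSet := fun e =>
    ⟨s(x e, y e), (toSimpleGraph_adj_iff _ _).2 (hxy e).adj⟩
  have hF : F.Injective := by
    intro e e' h
    have h2 : s(x e, y e) = s(x e', y e') := congrArg Subtype.val h
    refine Subtype.ext ?_
    rcases Sym2.eq_iff.1 h2 with ⟨h3, h4⟩ | ⟨h3, h4⟩
    · exact (hxy e).eq (h3 ▸ h4 ▸ hxy e')
    · exact (hxy e).eq (h3 ▸ h4 ▸ (hxy e').symm)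
  have hle := Nat.card_le_card_of_injective F hF
  refine ⟨Set.finite_coe_iff.1 (Finite.of_injective F hF), ?_⟩
  rw [← Nat.card_coe_set_eq, ← Nat.card_coe_set_eq]
  omega

/-- In a tree directed towards a root `r`, every vertex other than `r` owns exactly one edge. The
value `none` at `r` leaves room for one further edge at `r`. -/
lemma IsTree.exists_injective {α β : Type*} {T : Graph α β} {W : Set α} (hW : V(T) = W)
    (hfin : W.Finite) (hT : T.IsTree) (r : W) :
    ∃ g : W → Option β, g.Injective ∧ Set.range g = insert none (some '' E(T)) ∧ g r = none ∧
      ∀ v e, g v = some e → T.Inc e v := by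
  classical
  subst hW
  obtain ⟨hEfin, hcard⟩ := ncard_edgeSet_le_of_isTree hfin hT
  obtain ⟨hs, htree⟩ := hT
  let d : V(T) → ℕ := fun v => T.toSimpleGraph.dist v r
  -- Every vertex other than the root has an edge to a vertex closer to the root.
  have h1 : ∀ v : V(T), v ≠ r → ∃ e : β, ∃ w : V(T), T.IsLink e v w ∧ d w < d v := by
    intro v hv
    obtain ⟨p, hp⟩ := htree.connected.exists_walk_length_eq_dist v r
    cases p with
    | nil => exact absurd rfl hv
    | @cons _ w _ h q =>
      obtain ⟨e, he⟩ := (toSimpleGraph_adj_iff _ _).1 h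
      refine ⟨e, w, he, ?_⟩
      have := SimpleGraph.dist_le q
      simp only [SimpleGraph.Walk.length_cons] at hp
      change T.toSimpleGraph.dist w r < T.toSimpleGraph.dist v r
      omega
  choose e w hlink hlt using h1
  let g : V(T) → Option β := fun v => if hv : v = r then none else some (e v hv)
  have hgr : g r = none := by simp [g]
  have hg : ∀ v (hv : v ≠ r), g v = some (e v hv) := fun v hv => by simp [g, hv]
  have hinj : g.Injective := by
    intro u v huv
    by_cases hu : u = r <;> by_cases hv : v = r
    · rw [hu, hv]
    · rw [hu, hgr, hg v hv] at huv
      exact absurd huv (by simp)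
    · rw [hv, hgr, hg u hu] at huv
      exact absurd huv (by simp)
    · rw [hg u hu, hg v hv, Option.some_inj] at huv
      by_contra hne
      have h2 := hlink u hu
      rw [huv] at h2
      rcases h2.eq_and_eq_or_eq_and_eq (hlink v hv) with ⟨h3, -⟩ | ⟨h3, h4⟩
      · exact hne (Subtype.ext h3)
      · have h5 := hlt u hu
        have h6 := hlt v hv
        rw [Subtype.ext h4] at h5
        rw [← Subtype.ext h3] at h6
        omega
  have hinc : ∀ v f, g v = some f → T.Inc f v := by
    intro v f hf
    by_cases hv : v = r
    · rw [hv, hgr] at hf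
      exact absurd hf (by simp)
    · rw [hg v hv, Option.some_inj] at hf
      exact hf ▸ (hlink v hv).inc_left
  refine ⟨g, hinj, ?_, hgr, hinc⟩
  -- The range is contained in a set that is no larger, because a tree has one edge less than
  -- it has vertices.
  refine Set.eq_of_subset_of_ncard_le ?_ ?_ ((hEfin.image _).insert _)
  · rintro _ ⟨v, rfl⟩
    cases hgv : g v with
    | none => exact Set.mem_insert _ _
    | some f => exact Set.mem_insert_of_mem _ ⟨f, (hinc v f hgv).edge_mem, rfl⟩
  · rw [Set.ncard_insert_of_notMem (by simp) (hEfin.image _),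
      Set.ncard_image_of_injective _ (Option.some_injective β), ← Set.image_univ,
      Set.ncard_image_of_injective _ hinj, Set.ncard_univ, Nat.card_coe_set_eq]
    exact hcard

/-- A tree together with one more edge is a map, so the trees absorb the added edges. -/
lemma IsUnionOfTreesAndMaps.isKMap_addEdges {α β : Type*} {a b : ℕ} {G : Graph α β}
    (hfin : V(G).Finite) (hG : G.IsUnionOfTreesAndMaps a b) (f : Fin a → Sym2 V(G)) :
    (G.addEdges f).IsKMap (a + b) := by
  obtain ⟨T, M, hTM, hT, hM⟩ := hG
  have hTs : ∀ i, T i ≤s G := fun i => hTM.isSpanningSubgraph (Sum.inl i)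
  have hMs : ∀ j, M j ≤s G := fun j => hTM.isSpanningSubgraph (Sum.inr j)
  have h1 : ∀ i, ∃ r : V(G), r ∈ f i := fun i => by
    obtain ⟨⟨x, y⟩, h⟩ := (f i).exists_rep
    exact ⟨x, h ▸ Sym2.mem_mk_left x y⟩
  choose r hr using h1
  have h2 := fun i => (hT i).exists_injective (hTs i).vertexSet_eq hfin (r i)
  have h3 := fun j => (isMap_iff (hMs j).vertexSet_eq).1 (hM j)
  choose g hginj hgrange hgr hginc using h2
  choose m hminj hmrange hminc using h3
  -- In each tree, oriented towards `r i`, the root owns the added edge `f i`.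
  let F : V(G) × (Fin a ⊕ Fin b) → β ⊕ Fin a := fun p =>
    Sum.elim (fun i => (g i p.1).elim (Sum.inr i) Sum.inl) (fun j => Sum.inl (m j p.1)) p.2
  have hFinl : ∀ p e, F p = Sum.inl e → e ∈ E(Sum.elim T M p.2) ∧ G.Inc e p.1 := by
    rintro ⟨v, i | j⟩ e h
    · cases hgv : g i v with
      | none => simp [F, hgv] at h
      | some e' =>
        obtain rfl : e' = e := by simpa [F, hgv] using h
        exact ⟨(hginc i v _ hgv).edge_mem, (hginc i v _ hgv).mono (hTs i).le⟩
    · obtain rfl : m j v = e := by simpa [F] using h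
      exact ⟨(hminc j v).edge_mem, (hminc j v).mono (hMs j).le⟩
  have hFinr : ∀ p i, F p = Sum.inr i → p = (r i, Sum.inl i) := by
    rintro ⟨v, i' | j⟩ i h
    · cases hgv : g i' v with
      | none =>
        obtain rfl : i' = i := by simpa [F, hgv] using h
        exact Prod.ext (hginj i' (hgv.trans (hgr i').symm)) rfl
      | some e' => simp [F, hgv] at h
    · simp [F] at h
  have hFr : ∀ i, F (r i, Sum.inl i) = Sum.inr i := fun i => by simp [F, hgr]
  refine isKMap_of_injective (ι := Fin a ⊕ Fin b) (by simp) (m := F) ?_ ?_ ?_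
  · intro p q hpq
    cases hp : F p with
    | inr i => rw [hFinr p i hp, hFinr q i (hpq ▸ hp)]
    | inl e =>
      obtain ⟨v, c⟩ := p
      obtain ⟨w, c'⟩ := q
      have hq : F (w, c') = Sum.inl e := hpq ▸ hp
      obtain rfl : c = c' := by
        by_contra hne
        exact Set.disjoint_left.1 (hTM.disjoint _ _ hne) (hFinl _ _ hp).1 (hFinl _ _ hq).1
      refine Prod.ext ?_ rfl
      rcases c with i | j
      · refine hginj i ?_
        cases hgv : g i v <;> cases hgw : g i w <;> simp [F, hgv, hgw] at hp hq
        rw [hp, hq]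
      · refine hminj j ?_
        simp only [F, Sum.elim_inr, Sum.inl.injEq] at hp hq
        rw [hp, hq]
  · ext e
    rcases e with e | i
    · rw [inl_mem_edgeSet_addEdges, ← hTM.iUnion_edgeSet, Set.mem_iUnion]
      constructor
      · rintro ⟨p, hp⟩
        exact ⟨p.2, (hFinl p e hp).1⟩
      · rintro ⟨i | j, he⟩
        · obtain ⟨v, hv⟩ := (hgrange i).ge (Set.mem_insert_of_mem _ ⟨e, he, rfl⟩)
          exact ⟨(v, Sum.inl i), by simp [F, hv]⟩
        · obtain ⟨v, hv⟩ := (hmrange j).ge he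
          exact ⟨(v, Sum.inr j), by simp [F, hv]⟩
    · exact ⟨fun _ => inr_mem_edgeSet_addEdges i, fun _ => ⟨_, hFr i⟩⟩
  · intro p
    cases hp : F p with
    | inl e => exact addEdges_inc_inl.2 (hFinl p e hp).2
    | inr i =>
      rw [hFinr p i hp]
      exact addEdges_inc_inr.2 (hr i)

/-! ### Splitting off trees -/

open Finset in
/-- If `G` with the edges `f` added is a `k`-map, then the edges of `G` and the added edges can be
oriented so that every vertex has out-degree `k`. Here `t` and `q` give the tails of the edges of
`G` and of the added edges, and the out-degrees are summed over a vertex set `X`. -/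
lemma exists_tail_of_isKMap_addEdges {α β ι : Type*} [Fintype ι] {k : ℕ} {G : Graph α β}
    [Fintype V(G)] [DecidableEq V(G)] [Fintype E(G)] {f : ι → Sym2 V(G)}
    (hG : (G.addEdges f).IsKMap k) :
    ∃ (t : E(G) → V(G)) (q : ι → V(G)), (∀ e : E(G), G.Inc e (t e)) ∧ (∀ i, q i ∈ f i) ∧
      ∀ X : Finset V(G), #{e | t e ∈ X} + #{i | q i ∈ X} = k * #X := by
  obtain ⟨m, hinj, hrange, hinc⟩ := hG.exists_injective
  change V(G) × Fin k → _ at m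
  have h1 : ∀ e : E(G), ∃ p, m p = Sum.inl e.1 := fun e =>
    hrange.ge (inl_mem_edgeSet_addEdges.2 e.2)
  have h2 : ∀ i : ι, ∃ p, m p = Sum.inr i := fun i => hrange.ge (inr_mem_edgeSet_addEdges i)
  choose p hp using h1
  choose q hq using h2
  have hbij : (Sum.elim p q).Bijective := by
    constructor
    · rintro (e | i) (e' | i') h <;> replace h := congrArg m h <;> simp_all [Subtype.ext_iff]
    · intro x
      cases hx : m x with
      | inl e =>
        have he : Sum.inl e ∈ E(G.addEdges f) := hx ▸ (hinc x).edge_mem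
        rw [inl_mem_edgeSet_addEdges] at he
        exact ⟨Sum.inl ⟨e, he⟩, hinj ((hp ⟨e, he⟩).trans hx.symm)⟩
      | inr i => exact ⟨Sum.inr i, hinj ((hq i).trans hx.symm)⟩
  refine ⟨fun e => (p e).1, fun i => (q i).1, fun e => ?_, fun i => ?_, fun X => ?_⟩
  · have := hinc (p e)
    rwa [hp, addEdges_inc_inl] at this
  · have := hinc (q i)
    rwa [hq, addEdges_inc_inr] at this
  · have h3 := (Equiv.ofBijective _ hbij).sum_comp fun x : V(G) × Fin k => if x.1 ∈ X then 1 else 0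
    rw [Fintype.sum_sum_type, Fintype.sum_prod_type] at h3
    rw [card_filter, card_filter]
    calc
      _ = ∑ x : V(G), if x ∈ X then k else 0 :=
        h3.trans (sum_congr rfl fun x _ => by by_cases hx : x ∈ X <;> simp [hx])
      _ = k * #X := by simp [mul_comm]

lemma isTree_restrict_of_inArborescence {α β : Type*} {G : Graph α β} [Fintype V(G)]
    [DecidableEq V(G)] [DecidableEq E(G)] {t h : E(G) → V(G)}
    (hth : ∀ e : E(G), G.IsLink e (t e) (h e)) {r : V(G)} {T : Finset E(G)}
    (hT : InArborescence t h r Finset.univ T) :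
    (G.restrict (Subtype.val '' (T : Set E(G)))).IsTree := by
  set H := G.restrict (Subtype.val '' (T : Set E(G)))
  have hlink : ∀ e x y, H.IsLink e x y ↔
      ∃ e' ∈ T, e'.1 = e ∧ s(((t e' : V(G)) : α), (h e' : α)) = s(x, y) := by
    intro e x y
    constructor
    · rintro ⟨⟨e', he', rfl⟩, hl⟩
      exact ⟨e', he', rfl, ((hth e').isLink_iff_sym2_eq).1 hl⟩
    · rintro ⟨e', he', rfl, hs⟩
      exact ⟨⟨e', he', rfl⟩, ((hth e').isLink_iff_sym2_eq).2 hs⟩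
  have hsimple : H.Simple :=
    { not_isLoopAt := by
        intro e x hx
        obtain ⟨e', he', -, hs⟩ := (hlink _ _ _).1 hx
        refine hT.tail_ne_head e' he' (Subtype.ext ?_)
        grind
      eq_of_isLink := by
        intro e f x y he hf
        obtain ⟨e', he', rfl, hs⟩ := (hlink _ _ _).1 he
        obtain ⟨f', hf', rfl, hs'⟩ := (hlink _ _ _).1 hf
        refine congrArg _ (hT.eq_of_ends_eq e' he' f' hf' ?_)
        exact Sym2.map.injective Subtype.val_injective (hs.trans hs'.symm) }
  have hadj : ∀ e ∈ T, H.toSimpleGraph.Adj (t e) (h e) := fun e he =>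
    (toSimpleGraph_adj_iff _ _).2 ⟨e.1, (hlink _ _ _).2 ⟨e, he, rfl, rfl⟩⟩
  have hreach : ∀ v : V(G), H.toSimpleGraph.Reachable v r := fun v =>
    hT.reachable (S := H.toSimpleGraph) hadj v (@Finset.mem_univ V(G) _ v)
  have hconn : H.toSimpleGraph.Connected :=
    { preconnected := fun u v => (hreach u).trans (hreach v).symm
      nonempty := ⟨r⟩ }
  refine ⟨hsimple, ?_⟩
  have hfin : Finite V(H) := inferInstanceAs (Finite V(G))
  refine SimpleGraph.isTree_iff_connected_and_card.2
    ⟨hconn, le_antisymm ?_ hconn.card_vert_le_card_edgeSet_add_one⟩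
  have hsurj : Function.Surjective fun e : T =>
      (⟨s(t e, h e), hadj e e.2⟩ : H.toSimpleGraph.edgeSet) := by
    rintro ⟨⟨x, y⟩, hxy⟩
    obtain ⟨e, he⟩ := (toSimpleGraph_adj_iff _ _).1 hxy
    obtain ⟨e', he', -, hs⟩ := (hlink _ _ _).1 he
    exact ⟨⟨e', he'⟩, Subtype.ext (Sym2.map.injective Subtype.val_injective hs)⟩
  have h1 := Nat.card_le_card_of_surjective _ hsurj
  have h2 := hT.card_add_one
  have h3 : Nat.card V(H) = Fintype.card V(G) :=
    Nat.card_eq_fintype_card (α := V(G))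
  rw [Finset.card_univ] at h2
  rw [h3, ← h2]
  simpa using h1

open Finset in
/-- Disjoint spanning arborescences such that every vertex has out-degree `b` outside them yield a
decomposition into trees and maps. -/
lemma isUnionOfTreesAndMaps_of_inArborescence {α β : Type*} {a b : ℕ} {G : Graph α β}
    [Fintype V(G)] [DecidableEq V(G)] [Fintype E(G)] [DecidableEq E(G)] {t h : E(G) → V(G)}
    (hth : ∀ e : E(G), G.IsLink e (t e) (h e)) {T : Fin a → Finset E(G)}
    (hdisj : ∀ i j, i ≠ j → Disjoint (T i) (T j))
    (hT : ∀ i, ∃ r, InArborescence t h r Finset.univ (T i))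
    (hrest : ∀ v, #{e | t e = v ∧ ∀ i, e ∉ T i} = b) : G.IsUnionOfTreesAndMaps a b := by
  -- `c v` numbers the edges that leave `v` and lie in no arborescence.
  let c := fun v => (Finset.equivFinOfCardEq (hrest v)).symm
  let m : V(G) → Fin b → β := fun v j => (c v j).1
  have hc : ∀ v j, t (c v j).1 = v ∧ ∀ i, (c v j).1 ∉ T i := fun v j =>
    (Finset.mem_filter.1 (c v j).2).2
  have hminj : ∀ v w j j', m v j = m w j' → v = w ∧ j = j' := by
    intro v w j j' hvw
    have h1 : (c v j).1 = (c w j').1 := Subtype.ext hvw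
    obtain rfl : v = w := by rw [← (hc v j).1, h1, (hc w j').1]
    exact ⟨rfl, (c v).injective (Subtype.ext h1)⟩
  have hTm : ∀ i j, Disjoint (Subtype.val '' (T i : Set E(G))) (Set.range fun v => m v j) := by
    intro i j
    refine Set.disjoint_left.2 ?_
    rintro _ ⟨e, he, rfl⟩ ⟨v, hv⟩
    obtain rfl : (c v j).1 = e := Subtype.ext hv
    exact (hc v j).2 i he
  let S : Fin a ⊕ Fin b → Set β :=
    Sum.elim (fun i => Subtype.val '' (T i : Set E(G))) fun j => Set.range fun v => m v j
  have hS : G.IsEdgeDisjointUnion fun x => G.restrict (S x) := by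
    refine isEdgeDisjointUnion_restrict ?_ (Set.Subset.antisymm ?_ ?_)
    · rintro (i | j) (i' | j') hne
      · exact (Set.disjoint_image_iff Subtype.val_injective).2
          (Finset.disjoint_coe.2 (hdisj i i' fun hi => hne (congrArg _ hi)))
      · exact hTm i j'
      · exact (hTm i' j).symm
      · refine Set.disjoint_left.2 ?_
        rintro _ ⟨v, rfl⟩ ⟨w, hw⟩
        exact hne (congrArg _ (hminj _ _ _ _ hw).2.symm)
    · refine Set.iUnion_subset ?_
      rintro (i | j)
      · rintro _ ⟨e, -, rfl⟩
        exact e.2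
      · rintro _ ⟨v, rfl⟩
        exact (c v j).1.2
    · intro e he
      rw [Set.mem_iUnion]
      by_cases hi : ∃ i, (⟨e, he⟩ : E(G)) ∈ T i
      · obtain ⟨i, hi⟩ := hi
        exact ⟨Sum.inl i, ⟨e, he⟩, hi, rfl⟩
      · rw [not_exists] at hi
        obtain ⟨j, hj⟩ := (c (t ⟨e, he⟩)).surjective ⟨⟨e, he⟩, by simpa using hi⟩
        exact ⟨Sum.inr j, t ⟨e, he⟩, by simp [m, hj]⟩
  refine ⟨fun i => G.restrict (S (Sum.inl i)), fun j => G.restrict (S (Sum.inr j)), ?_, ?_, ?_⟩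
  · convert hS using 1
    ext1 x
    cases x <;> rfl
  · intro i
    obtain ⟨r, hr⟩ := hT i
    exact isTree_restrict_of_inArborescence hth hr
  · intro j
    refine isMap_restrict_range (fun v w hvw => (hminj v w j j hvw).1) fun v => ?_
    have := (hth (c v j).1).inc_left
    rwa [(hc v j).1] at this

open Finset in
/-- If adding any `ℓ` edges gives a `k`-map, then `G` splits into trees and maps. The
loops at `r` provide an orientation of `G` with out-degree `k - ℓ` at `r` and `k` elsewhere; the
loops at the vertices of `X` bound the number of edges inside `X` by `k * #X - ℓ`. Hence at least
`ℓ` edges leave each `X` that avoids `r`, and Edmonds' theorem applies. -/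
lemma isUnionOfTreesAndMaps_of_forall_isKMap {α β : Type*} {k ℓ : ℕ} {G : Graph α β}
    [Fintype V(G)] [DecidableEq V(G)] [Fintype E(G)] [DecidableEq E(G)]
    (hne : 0 < ℓ → V(G).Nonempty) (hG : ∀ f : Fin ℓ → Sym2 V(G), (G.addEdges f).IsKMap k) :
    G.IsUnionOfTreesAndMaps ℓ (k - ℓ) := by
  rcases Nat.eq_zero_or_pos ℓ with rfl | hℓ
  · obtain ⟨t, q, ht, hq, hcard⟩ := exists_tail_of_isKMap_addEdges (hG Fin.elim0)
    choose h hh using ht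
    refine isUnionOfTreesAndMaps_of_inArborescence (t := t)
      (h := fun e => ⟨h e, (hh e).right_mem⟩) hh (T := Fin.elim0) (fun i => i.elim0)
      (fun i => i.elim0) fun v => ?_
    simpa using hcard {v}
  · obtain ⟨r, hr⟩ := hne hℓ
    lift r to V(G) using hr
    have hloops : ∀ x : V(G), ∃ t : E(G) → V(G), (∀ e : E(G), G.Inc e (t e)) ∧
        ∀ X : Finset V(G), #{e | t e ∈ X} + (if x ∈ X then ℓ else 0) = k * #X := by
      intro x
      obtain ⟨t, q, ht, hq, hcard⟩ := exists_tail_of_isKMap_addEdges (hG fun _ => s(x, x))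
      refine ⟨t, ht, fun X => ?_⟩
      have hqx : ∀ i, q i = x := fun i => by simpa using hq i
      rw [← hcard X]
      split_ifs with hx <;> simp [hqx, hx]
    obtain ⟨t, ht, hcard⟩ := hloops r
    choose h hh using ht
    lift h to E(G) → V(G) using fun e => (hh e).right_mem
    -- Compare the orientation for `r` with the one for some `x ∈ X`: an edge inside `X` has its tail
    -- in `X` in both.
    have hcut : ∀ X : Finset V(G), X.Nonempty → r ∉ X → ℓ ≤ cutDegree t h univ X := by
      rintro X ⟨x, hx⟩ hrX
      obtain ⟨t', ht', hcard'⟩ := hloops x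
      have h1 := hcard X
      have h2 := hcard' X
      rw [if_neg hrX] at h1
      rw [if_pos hx] at h2
      have h3 : #{e | t e ∈ X ∧ h e ∈ X} ≤ #{e | t' e ∈ X} := by
        refine card_le_card fun e he => ?_
        simp only [mem_filter, mem_univ, true_and] at he ⊢
        rcases (ht' e).eq_or_eq_of_isLink (hh e) with h4 | h4
        · rw [Subtype.ext h4]; exact he.1
        · rw [Subtype.ext h4]; exact he.2
      have h4 := card_filter_add_card_filter_not (s := {e | t e ∈ X}) (fun e => h e ∈ X)
      rw [filter_filter, filter_filter] at h4
      unfold cutDegree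
      omega
    obtain ⟨T, -, hdisj, hT⟩ := exists_disjoint_inArborescence hcut
    refine isUnionOfTreesAndMaps_of_inArborescence hh hdisj (fun i => ⟨r, hT i⟩) fun v => ?_
    have h1 := hcard {v}
    have h2 := card_filter_add_card_filter_not (s := {e | t e = v}) (fun e => ∀ i, e ∉ T i)
    have h3 : #{e ∈ ({e | t e = v} : Finset E(G)) | ¬ ∀ i, e ∉ T i} = if v = r then 0 else ℓ := by
      have h4 : ({e ∈ ({e | t e = v} : Finset E(G)) | ¬ ∀ i, e ∉ T i} : Finset E(G)) =
          univ.biUnion fun i => {e ∈ T i | t e = v} := by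
        ext e
        simp [and_comm]
      rw [h4, card_biUnion fun i _ j _ hij =>
        (hdisj i j hij).mono (filter_subset _ _) (filter_subset _ _),
        sum_congr rfl fun i _ => (hT i).card_filter_tail v (mem_univ v)]
      split_ifs <;> simp
    rw [filter_filter] at h2
    simp only [mem_singleton, card_singleton, mul_one, eq_comm (a := r)] at h1
    split_ifs at h1 h3 <;> omega

end Graph

theorem corollary1 {α β : Type*} (k ℓ n : ℕ) (hℓ : ℓ ≤ k) (G : Graph α β)
    (hVfin : V(G).Finite) (hEfin : E(G).Finite)
    (hV : V(G).ncard = n) (hE : (E(G).ncard : ℤ) = k * n - ℓ) :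
    G.IsUnionOfTreesAndMaps ℓ (k - ℓ) ↔
      ∀ f : Fin ℓ → Sym2 V(G), (G.addEdges f).IsKMap k := by
  classical
  constructor
  · intro hG f
    have := hG.isKMap_addEdges hVfin f
    rwa [Nat.add_sub_cancel' hℓ] at this
  · intro hG
    have := hVfin.fintype
    have := hEfin.fintype
    refine Graph.isUnionOfTreesAndMaps_of_forall_isKMap (fun hpos => ?_) hG
    -- The empty graph has no edges, whereas `k * 0 - ℓ` is negative.
    refine Set.nonempty_iff_ne_empty.2 fun hempty => ?_
    rw [hempty, Set.ncard_empty] at hV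
    subst hV
    simp only [Nat.cast_zero, mul_zero] at hE
    omega
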